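/- Let $A$ be a rational $(n-1)\times n$ matrix of rank $n-1$, let $\pi:\mathbb{R}^n\to\mathbb{R}^{n-1}$, $x\mapsto Ax$, and let $\psi=\pi^\circ:\mathbb{R}^n\to\mathbb{R}$ be a linear map whose kernel is the row space of $A$. For a polytope $P$ and $w\in\mathbb{R}^n$ put $\mathrm{face}_w(P)=\{x\in P: w^Tx=\max_{y\in P}w^Ty\}$. The fiber polytope of $P$ is the Minkowski integral $\Sigma_\psi(P)=\int_{\psi(P)}(\psi^{-1}(x)\cap P)\,dx$, i.e. the set of integrals $\int_{\psi(P)}s(x)\,dx$ of all measurable sections $s$ of $\psi:P\to\psi(P)$. The mixed fiber polytope $\Sigma_\psi(P_1,P_2)$ is the polytope $M$ for which there are polytopes $M_{20},M_{02}$ with $\Sigma_\psi(\lambda_1P_1+\lambda_2P_2)=\lambda_1^2M_{20}+\lambda_1\lambda_2M+\lambda_2^2M_{02}$ for all $\lambda_1,\lambda_2>0$. For polytopes, $P-Q=R$ means $P=Q+R$ (Minkowski sum). Let $C,D\subseteq\mathbb{R}^n$ be lattice polytopes of positive dimension (the summands of a mixed cell $C+D$) such that $D$ and $\psi(D)$ are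 one-dimensional, and let $w\in\mathbb{R}^n$ be such that $\mathrm{face}_w(C)+D$ is a facet of $C+D$ with outer normal vector $w$, i.e. $\mathrm{face}_w(C)+D=\mathrm{face}_w(C+D)$ and this face has dimension $\dim(C+D)-1$. Then $\Sigma_\psi(C,D)$ and $\Sigma_\psi(\mathrm{face}_w(C),D)$ exist and are unique, and the difference $$v(C,D,w)=\Sigma_\psi(\mathrm{face}_w(C),D)-\mathrm{face}_w(\Sigma_\psi(C,D))$$ is a $0$-dimensional polytope, i.e. there is exactly one $v\in\mathbb{R}^n$ with $\Sigma_\psi(\mathrm{face}_w(C),D)=\mathrm{face}_w(\Sigma_\psi(C,D))+\{v\}$. Consequently, let $C',D'$ satisfy the same hypotheses with respect to $-w$, and let the two cells be neighbors, i.e. the facets $\mathrm{face}_w(C)+D$ and $\mathrm{face}_{-w}(C')+D'$ have the same summands: either $\mathrm{face}_w(C)=\mathrm{face}_{-w}(C')$ and $D=D'$, or $\mathrm{face}_w(C)=D'$ and $D=\mathrm{face}_{-w}(C')$. Then translating $\Sigma_\psi(C,D)$ by the offset $v(C,D,w)-v(C',D',-w)$ makes the corresponding faces coincide: $$\mathrm{face}_{-w}(\Sigma_\psi(C',D'))=\mathrm{face}_w(\Sigma_\psi(C,D))+\{v(C,D,w)-v(C',D',-w)\}.$$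 -/

import Mathlib

open MeasureTheory
open scoped Pointwise

namespace MixedFiber

/-- A (nonempty) polytope: the convex hull of a nonempty finite set of points. -/
def IsPolytope {n : ℕ} (P : Set (EuclideanSpace ℝ (Fin n))) : Prop :=
  ∃ V : Finset (EuclideanSpace ℝ (Fin n)), V.Nonempty ∧
    P = convexHull ℝ (V : Set (EuclideanSpace ℝ (Fin n)))

/-- A lattice polytope: the convex hull of a nonempty finite set of integral points. -/
def IsLatticePolytope {n : ℕ} (P : Set (EuclideanSpace ℝ (Fin n))) : Prop :=
  ∃ V : Finset (Fin n → ℤ), V.Nonempty ∧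
    P = convexHull ℝ ((fun a : Fin n → ℤ =>
      (WithLp.toLp 2 (fun j => (a j : ℝ)) : EuclideanSpace ℝ (Fin n))) '' (V : Set (Fin n → ℤ)))

/-- The dimension of a nonempty set: the dimension of its affine hull. -/
noncomputable def affDim {E : Type*} [AddCommGroup E] [Module ℝ E] (P : Set E) : ℕ :=
  Module.finrank ℝ (vectorSpan ℝ P)

/-- `face w P` is the set of points of `P` at which `x ↦ wᵀ x` attains its maximum over `P`. -/
def face {n : ℕ} (w : EuclideanSpace ℝ (Fin n)) (P : Set (EuclideanSpace ℝ (Fin n))) :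
    Set (EuclideanSpace ℝ (Fin n)) :=
  {x | x ∈ P ∧ ∀ y ∈ P, inner ℝ w y ≤ inner ℝ w x}

/-- `G` is the facet of `P` with outer normal vector `w`. -/
def IsFacet {n : ℕ} (w : EuclideanSpace ℝ (Fin n)) (G P : Set (EuclideanSpace ℝ (Fin n))) :
    Prop :=
  G = face w P ∧ affDim G + 1 = affDim P

/-- `ψ : ℝⁿ → ℝ` is a map complementary to the projection `π : ℝⁿ → ℝⁿ⁻¹`, `x ↦ A x`, where `A`
is a rational matrix of full rank `n - 1`: the kernel of `ψ` is the row space of `A`. -/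
def IsComplementaryMap {n : ℕ} (A : Matrix (Fin (n - 1)) (Fin n) ℚ)
    (ψ : EuclideanSpace ℝ (Fin n) →ₗ[ℝ] ℝ) : Prop :=
  A.rank = n - 1 ∧
    LinearMap.ker ψ = Submodule.span ℝ (Set.range fun i : Fin (n - 1) =>
      (WithLp.toLp 2 (fun j => (A i j : ℝ)) : EuclideanSpace ℝ (Fin n)))

/-- The fiber polytope `∫_{ψ(P)} (ψ⁻¹(x) ∩ P) dx`. The Minkowski integral is the set of the
integrals of all measurable sections of `ψ : P → ψ(P)`. (Such a section takes values in `P`, so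
it is integrable over `ψ(P)` when `P` is compact.) -/
def fiberPolytope {n : ℕ} (ψ : EuclideanSpace ℝ (Fin n) →ₗ[ℝ] ℝ)
    (P : Set (EuclideanSpace ℝ (Fin n))) : Set (EuclideanSpace ℝ (Fin n)) :=
  {z | ∃ s : ℝ → EuclideanSpace ℝ (Fin n), Measurable s ∧
    (∀ x ∈ ψ '' P, s x ∈ P ∧ ψ (s x) = x) ∧ z = ∫ x in ψ '' P, s x}

/-- `M` is the coefficient of `l₁ l₂` in an expansion of the fiber polytope of `l₁ P₁ + l₂ P₂`,
`l₁, l₂ > 0`, as a homogeneous polynomial of degree two with polytopes as coefficients. -/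
def IsMixedFiberPolytope {n : ℕ} (ψ : EuclideanSpace ℝ (Fin n) →ₗ[ℝ] ℝ)
    (P₁ P₂ M : Set (EuclideanSpace ℝ (Fin n))) : Prop :=
  IsPolytope M ∧ ∃ M₂₀ M₀₂ : Set (EuclideanSpace ℝ (Fin n)), IsPolytope M₂₀ ∧ IsPolytope M₀₂ ∧
    ∀ l₁ l₂ : ℝ, 0 < l₁ → 0 < l₂ →
      fiberPolytope ψ (l₁ • P₁ + l₂ • P₂) = l₁ ^ 2 • M₂₀ + (l₁ * l₂) • M + l₂ ^ 2 • M₀₂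

/-- The mixed fiber polytope of `P₁` and `P₂`: the set `M` with `IsMixedFiberPolytope ψ P₁ P₂ M`
(an arbitrary set if there is none). -/
noncomputable def mixedFiberPolytope {n : ℕ} (ψ : EuclideanSpace ℝ (Fin n) →ₗ[ℝ] ℝ)
    (P₁ P₂ : Set (EuclideanSpace ℝ (Fin n))) : Set (EuclideanSpace ℝ (Fin n)) :=
  Classical.epsilon (IsMixedFiberPolytope ψ P₁ P₂)

/-- The summands of a mixed cell `C + D` are lattice polytopes of positive dimension. -/
structure IsMixedCell {n : ℕ} (C D : Set (EuclideanSpace ℝ (Fin n))) : Prop where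
  lattice_left : IsLatticePolytope C
  lattice_right : IsLatticePolytope D
  dim_left : 1 ≤ affDim C
  dim_right : 1 ≤ affDim D

/-- `C + D` is a mixed cell, `D` and `ψ(D)` are one-dimensional, and `face w C + D` is a facet
of `C + D`, with outer normal vector `w`. -/
structure IsEdgeCell {n : ℕ} (ψ : EuclideanSpace ℝ (Fin n) →ₗ[ℝ] ℝ)
    (w : EuclideanSpace ℝ (Fin n)) (C D : Set (EuclideanSpace ℝ (Fin n))) : Prop where
  mixed : IsMixedCell C D
  dim_right : affDim D = 1
  dim_image : affDim (ψ '' D) = 1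
  facet : IsFacet w (face w C + D) (C + D)

/-- The formal difference of the polytopes `P` and `Q` is the polytope `R`. -/
def IsDifference {n : ℕ} (P Q R : Set (EuclideanSpace ℝ (Fin n))) : Prop :=
  P = Q + R

/-- The facet of `C₁ + D₁` in direction `w` and the facet of `C₂ + D₂` in direction `-w`
are the same cell, written with the same two summands (the one-dimensional summands `D₁` and `D₂`
may belong to the same Newton polytope or to different ones). -/
def AreNeighbors {n : ℕ} (w : EuclideanSpace ℝ (Fin n))
    (C₁ D₁ C₂ D₂ : Set (EuclideanSpace ℝ (Fin n))) : Prop :=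
  (face w C₁ = face (-w) C₂ ∧ D₁ = D₂) ∨ (face w C₁ = D₂ ∧ D₁ = face (-w) C₂)

end MixedFiber

namespace MixedFiber

/-! ### Polytopes, faces and support functions. -/

section Polytopes

variable {n : ℕ}

/-! The hypotheses on `D` make it a segment `[d₀, d₁]` with `ψ d₀ < ψ d₁`. For such `D` the mixed
fiber polytope is explicit: if `ψ(C) = [a, b]`, it is `p(C) + {b d₁ - a d₀}`, where `p x = (ψ d₁ - ψ
d₀) x - ψ(x) (d₁ - d₀)` is a multiple of the projection along `D` (`isMixedFiberPolytope_segment`).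
Since `face w C + D` is a face, `w` is constant on `D`, so `p` multiplies `⟪w, ·⟫` by `ψ d₁ - ψ d₀ >
0` and commutes with taking faces in direction `w`. Hence both polytopes in the difference are
translates of `p(face w C)`.

The explicit formula rests on `fiberPolytope_add_segment`. Cutting a section of `K` at the height of
a point `q ∈ K` and inserting the segment there gives a section of the sum whose integral is linear
in the projection of `q`; optimal sections in each direction arise this way, up to finitely many
heights.

Uniqueness of the mixed fiber polytope follows from support functions, which turn Minkowski sums
into sums. Neighboring cells share the mixed fiber polytope of their common facet, which is
symmetric in the two summands, so the two differences subtract to the offset. -/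

theorem isPolytope_iff {P : Set (EuclideanSpace ℝ (Fin n))} :
    IsPolytope P ↔ ∃ V : Set (EuclideanSpace ℝ (Fin n)), V.Finite ∧ V.Nonempty ∧
      P = convexHull ℝ V := by
  constructor
  · rintro ⟨V, hV, rfl⟩
    exact ⟨V, V.finite_toSet, hV, rfl⟩
  · rintro ⟨V, hf, hV, rfl⟩
    exact ⟨hf.toFinset, by simpa using hV, by simp⟩

theorem IsLatticePolytope.isPolytope {P : Set (EuclideanSpace ℝ (Fin n))}
    (h : IsLatticePolytope P) : IsPolytope P := by
  obtain ⟨V, hV, rfl⟩ := h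
  exact isPolytope_iff.2 ⟨_, V.finite_toSet.image _, hV.to_set.image _, rfl⟩

namespace IsPolytope

variable {P Q : Set (EuclideanSpace ℝ (Fin n))}

theorem nonempty (h : IsPolytope P) : P.Nonempty := by
  obtain ⟨V, hV, rfl⟩ := h
  exact hV.to_set.convexHull

theorem isCompact (h : IsPolytope P) : IsCompact P := by
  obtain ⟨V, hV, rfl⟩ := h
  exact V.finite_toSet.isCompact_convexHull ℝ

theorem convex (h : IsPolytope P) : Convex ℝ P := by
  obtain ⟨V, hV, rfl⟩ := h
  exact convex_convexHull ℝ _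

theorem singleton (v : EuclideanSpace ℝ (Fin n)) : IsPolytope {v} :=
  isPolytope_iff.2 ⟨{v}, Set.finite_singleton v, Set.singleton_nonempty v, by simp⟩

theorem add (hP : IsPolytope P) (hQ : IsPolytope Q) : IsPolytope (P + Q) := by
  obtain ⟨V, hVf, hV, rfl⟩ := isPolytope_iff.1 hP
  obtain ⟨W, hWf, hW, rfl⟩ := isPolytope_iff.1 hQ
  exact isPolytope_iff.2 ⟨V + W, hVf.add hWf, hV.add hW, (convexHull_add V W).symm⟩

theorem image (hP : IsPolytope P)
    (f : EuclideanSpace ℝ (Fin n) →ₗ[ℝ] EuclideanSpace ℝ (Fin n)) : IsPolytope (f '' P) := by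
  obtain ⟨V, hVf, hV, rfl⟩ := isPolytope_iff.1 hP
  exact isPolytope_iff.2 ⟨f '' V, hVf.image _, hV.image _, f.image_convexHull V⟩

theorem smul (hP : IsPolytope P) (c : ℝ) : IsPolytope (c • P) := by
  obtain ⟨V, hVf, hV, rfl⟩ := isPolytope_iff.1 hP
  exact isPolytope_iff.2 ⟨c • V, hVf.image _, hV.image _, (convexHull_smul c V).symm⟩

/-- Faces of polytopes are polytopes. -/
theorem face (hP : IsPolytope P) (w : EuclideanSpace ℝ (Fin n)) : IsPolytope (face w P) := by
  have hexp : IsExposed ℝ P (MixedFiber.face w P) := fun _ => ⟨innerSL ℝ w, rfl⟩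
  have hcpt : IsCompact (MixedFiber.face w P) := hexp.isCompact hP.isCompact
  have hconv : Convex ℝ (MixedFiber.face w P) := hexp.convex hP.convex
  have hne : (MixedFiber.face w P).Nonempty := by
    obtain ⟨x, hx, hmax⟩ := hP.isCompact.exists_isMaxOn hP.nonempty
      (f := fun y => inner ℝ w y) (by fun_prop)
    exact ⟨x, hx, fun y hy => hmax hy⟩
  -- Extreme points of an exposed face are extreme in `P`, hence lie in the finite generating set;
  -- Krein–Milman then recovers the face.
  have hext : (MixedFiber.face w P).extremePoints ℝ ⊆ P.extremePoints ℝ :=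
    hexp.isExtreme.extremePoints_subset_extremePoints
  have hfin : ((MixedFiber.face w P).extremePoints ℝ).Finite := by
    obtain ⟨V, hV, rfl⟩ := hP
    exact V.finite_toSet.subset (hext.trans extremePoints_convexHull_subset)
  refine isPolytope_iff.2 ⟨_, hfin, hcpt.extremePoints_nonempty hne, ?_⟩
  rw [← (hfin.isClosed_convexHull ℝ).closure_eq]
  exact (closure_convexHull_extremePoints hcpt hconv).symm

end IsPolytope

/-- A compact convex set contains every point which it dominates in all directions. -/
theorem mem_of_forall_inner_le {Q : Set (EuclideanSpace ℝ (Fin n))} (hQ : IsCompact Q)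
    (hconv : Convex ℝ Q) {z : EuclideanSpace ℝ (Fin n)}
    (h : ∀ u : EuclideanSpace ℝ (Fin n), ∃ q ∈ Q, inner ℝ u z ≤ inner ℝ u q) : z ∈ Q := by
  by_contra hz
  obtain ⟨f, c, hf, hc⟩ := geometric_hahn_banach_closed_point hconv hQ.isClosed hz
  obtain ⟨q, hq, hle⟩ := h ((InnerProductSpace.toDual ℝ _).symm f)
  simp only [InnerProductSpace.toDual_symm_apply] at hle
  linarith [hf q hq]

/-- The support function of a set. -/
noncomputable def support (P : Set (EuclideanSpace ℝ (Fin n))) (u : EuclideanSpace ℝ (Fin n)) :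
    ℝ :=
  sSup (innerSL ℝ u '' P)

theorem support_add {P Q : Set (EuclideanSpace ℝ (Fin n))} (hP : IsPolytope P)
    (hQ : IsPolytope Q) (u : EuclideanSpace ℝ (Fin n)) :
    support (P + Q) u = support P u + support Q u := by
  unfold support
  rw [Set.image_add]
  exact csSup_add (hP.nonempty.image _)
    (hP.isCompact.image (innerSL ℝ u).continuous).bddAbove (hQ.nonempty.image _)
    (hQ.isCompact.image (innerSL ℝ u).continuous).bddAbove

theorem support_smul {P : Set (EuclideanSpace ℝ (Fin n))} {c : ℝ} (hc : 0 ≤ c)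
    (u : EuclideanSpace ℝ (Fin n)) : support (c • P) u = c * support P u := by
  unfold support
  rw [image_smul_set, Real.sSup_smul_of_nonneg hc, smul_eq_mul]

theorem support_singleton (v u : EuclideanSpace ℝ (Fin n)) : support {v} u = inner ℝ u v := by
  simp [support]

theorem subset_of_support_le {P Q : Set (EuclideanSpace ℝ (Fin n))} (hP : IsPolytope P)
    (hQ : IsPolytope Q) (h : ∀ u, support P u ≤ support Q u) : P ⊆ Q := by
  intro z hz
  refine mem_of_forall_inner_le hQ.isCompact hQ.convex fun u => ?_
  obtain ⟨q, hq, he⟩ := (hQ.isCompact.image (innerSL ℝ u).continuous).sSup_mem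
    (hQ.nonempty.image _)
  refine ⟨q, hq, ?_⟩
  have h1 : inner ℝ u z ≤ support P u :=
    le_csSup (hP.isCompact.image (innerSL ℝ u).continuous).bddAbove ⟨z, hz, rfl⟩
  have h2 : support Q u = inner ℝ u q := he.symm
  linarith [h u]

/-- Two translation vectors which move a polytope to the same set agree. -/
theorem eq_of_add_singleton_eq {P : Set (EuclideanSpace ℝ (Fin n))} (hP : IsPolytope P)
    {v w : EuclideanSpace ℝ (Fin n)} (h : P + {v} = P + {w}) : v = w := by
  refine ext_inner_left ℝ fun u => ?_
  have := congrArg (fun X => support X u) h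
  simpa only [support_add hP (.singleton _), support_singleton, add_right_inj] using this

/-- In each direction, support functions turn the expansion into a quadratic form in `l₁, l₂`, whose
coefficients are determined; a polytope is determined by its support function. -/
theorem IsMixedFiberPolytope.unique {ψ : EuclideanSpace ℝ (Fin n) →ₗ[ℝ] ℝ}
    {P₁ P₂ M M' : Set (EuclideanSpace ℝ (Fin n))} (h : IsMixedFiberPolytope ψ P₁ P₂ M)
    (h' : IsMixedFiberPolytope ψ P₁ P₂ M') : M = M' := by
  obtain ⟨hM, A, B, hA, hB, hAB⟩ := h
  obtain ⟨hM', A', B', hA', hB', hAB'⟩ := h'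
  have key : ∀ u, support M u = support M' u := by
    intro u
    have eq : ∀ l₁ l₂ : ℝ, 0 < l₁ → 0 < l₂ →
        l₁ ^ 2 * support A u + l₁ * l₂ * support M u + l₂ ^ 2 * support B u =
        l₁ ^ 2 * support A' u + l₁ * l₂ * support M' u + l₂ ^ 2 * support B' u := by
      intro l₁ l₂ h₁ h₂
      have := congrArg (fun X => support X u) ((hAB l₁ l₂ h₁ h₂).symm.trans (hAB' l₁ l₂ h₁ h₂))
      have h12 : 0 ≤ l₁ * l₂ := by positivity
      simpa only [support_add (((hA.smul _).add (hM.smul _))) (hB.smul _),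
        support_add (hA.smul _) (hM.smul _),
        support_add (((hA'.smul _).add (hM'.smul _))) (hB'.smul _),
        support_add (hA'.smul _) (hM'.smul _),
        support_smul (sq_nonneg l₁), support_smul (sq_nonneg l₂), support_smul h12] using this
    -- The values of `l₁²`, `l₁ l₂`, `l₂²` at these three points form an invertible matrix.
    have e₁ := eq 1 1 one_pos one_pos
    have e₂ := eq 2 1 two_pos one_pos
    have e₃ := eq 1 2 one_pos two_pos
    linarith
  exact (subset_of_support_le hM hM' fun u => (key u).le).antisymm
    (subset_of_support_le hM' hM fun u => (key u).ge)

theorem IsMixedFiberPolytope.symm {ψ : EuclideanSpace ℝ (Fin n) →ₗ[ℝ] ℝ}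
    {P₁ P₂ M : Set (EuclideanSpace ℝ (Fin n))} (h : IsMixedFiberPolytope ψ P₁ P₂ M) :
    IsMixedFiberPolytope ψ P₂ P₁ M := by
  obtain ⟨hM, A, B, hA, hB, hAB⟩ := h
  refine ⟨hM, B, A, hB, hA, fun l₁ l₂ h₁ h₂ => ?_⟩
  rw [add_comm (l₁ • P₂), hAB l₂ l₁ h₂ h₁, mul_comm l₂ l₁]
  abel

theorem IsMixedFiberPolytope.mixedFiberPolytope_eq {ψ : EuclideanSpace ℝ (Fin n) →ₗ[ℝ] ℝ}
    {P₁ P₂ M : Set (EuclideanSpace ℝ (Fin n))} (h : IsMixedFiberPolytope ψ P₁ P₂ M) :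
    mixedFiberPolytope ψ P₁ P₂ = M :=
  (Classical.epsilon_spec (p := IsMixedFiberPolytope ψ P₁ P₂) ⟨M, h⟩).unique h

theorem face_add_singleton (w v : EuclideanSpace ℝ (Fin n))
    (P : Set (EuclideanSpace ℝ (Fin n))) : face w (P + {v}) = face w P + {v} := by
  ext x
  simp only [Set.add_singleton, face, Set.mem_ofPred_eq, Set.mem_image]
  constructor
  · rintro ⟨⟨y, hy, rfl⟩, h⟩
    refine ⟨y, ⟨hy, fun z hz => ?_⟩, rfl⟩
    have := h _ ⟨z, hz, rfl⟩
    simpa [inner_add_right] using this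
  · rintro ⟨y, ⟨hy, h⟩, rfl⟩
    refine ⟨⟨y, hy, rfl⟩, ?_⟩
    rintro _ ⟨z, hz, rfl⟩
    simpa [inner_add_right] using h z hz

/-- If `f` multiplies the functional `⟪w, ·⟫` by a positive factor, then it maps faces in
direction `w` to faces in direction `w`. -/
theorem face_image {w : EuclideanSpace ℝ (Fin n)} {c : ℝ} (hc : 0 < c)
    {f : EuclideanSpace ℝ (Fin n) →ₗ[ℝ] EuclideanSpace ℝ (Fin n)}
    (hf : ∀ x, inner ℝ w (f x) = c * inner ℝ w x) (P : Set (EuclideanSpace ℝ (Fin n))) :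
    face w (f '' P) = f '' face w P := by
  ext x
  simp only [face, Set.mem_ofPred_eq, Set.mem_image]
  constructor
  · rintro ⟨⟨y, hy, rfl⟩, h⟩
    refine ⟨y, ⟨hy, fun z hz => ?_⟩, rfl⟩
    have := h _ ⟨z, hz, rfl⟩
    rw [hf, hf] at this
    exact le_of_mul_le_mul_left this hc
  · rintro ⟨y, ⟨hy, h⟩, rfl⟩
    refine ⟨⟨y, hy, rfl⟩, ?_⟩
    rintro _ ⟨z, hz, rfl⟩
    rw [hf, hf]
    exact mul_le_mul_of_nonneg_left (h z hz) hc.le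

end Polytopes

/-! ### Maximal sections; fiber polytopes are polytopes. -/

variable {n : ℕ} {ψ : EuclideanSpace ℝ (Fin n) →ₗ[ℝ] ℝ}

/-- The point at height `ψ = x` on the line through `v` and `w`. -/
noncomputable def chord (ψ : EuclideanSpace ℝ (Fin n) →ₗ[ℝ] ℝ) (v w : EuclideanSpace ℝ (Fin n))
    (x : ℝ) : EuclideanSpace ℝ (Fin n) :=
  v + ((x - ψ v) / (ψ w - ψ v)) • (w - v)

theorem measurable_chord (v w : EuclideanSpace ℝ (Fin n)) : Measurable (chord ψ v w) := by
  unfold chord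
  fun_prop

theorem map_chord {v w : EuclideanSpace ℝ (Fin n)} {x : ℝ} (hv : ψ v ≤ x) (hw : x ≤ ψ w) :
    ψ (chord ψ v w x) = x := by
  rcases (hv.trans hw).eq_or_lt with h | h
  -- For equal heights, division by zero gives the point `v`, which already has height `x`.
  · simp [chord, ← h, le_antisymm hv (h ▸ hw)]
  · have : ψ w - ψ v ≠ 0 := (sub_pos.2 h).ne'
    simp only [chord, map_add, map_smul, map_sub, smul_eq_mul]
    field_simp
    ring

theorem chord_mem_segment {v w : EuclideanSpace ℝ (Fin n)} {x : ℝ} (hv : ψ v ≤ x)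
    (hw : x ≤ ψ w) : chord ψ v w x ∈ segment ℝ v w := by
  rw [segment_eq_image']
  exact ⟨_, ⟨div_nonneg (sub_nonneg.2 hv) (sub_nonneg.2 (hv.trans hw)),
    div_le_one_of_le₀ (by linarith) (sub_nonneg.2 (hv.trans hw))⟩, rfl⟩

/-- Over a point `x` which is not the height of a vertex, there is an edge of the upper boundary
in direction `u`. -/
theorem exists_supporting_chord {V : Set (EuclideanSpace ℝ (Fin n))} (hV : V.Finite) {x : ℝ}
    (hx : x ∈ ψ '' convexHull ℝ V) (hxV : x ∉ ψ '' V) (u : EuclideanSpace ℝ (Fin n)) :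
    ∃ v ∈ V, ∃ w ∈ V, ψ v < x ∧ x < ψ w ∧ ∃ α m : ℝ, (∀ z ∈ V, inner ℝ u z ≤ α + m * ψ z) ∧
      inner ℝ u v = α + m * ψ v ∧ inner ℝ u w = α + m * ψ w := by
  obtain ⟨y, hy, rfl⟩ := hx
  have hl : {v ∈ V | ψ v < ψ y}.Nonempty := by
    by_contra hne
    have : convexHull ℝ V ⊆ {z | ψ y < ψ z} := by
      refine convexHull_min (fun v hv => ?_) (convex_halfSpace_gt ψ.isLinear _)
      rcases lt_trichotomy (ψ v) (ψ y) with h | h | h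
      · exact (hne ⟨v, hv, h⟩).elim
      · exact (hxV ⟨v, hv, h⟩).elim
      · exact h
    exact lt_irrefl (ψ y) (this hy)
  have hr : {v ∈ V | ψ y < ψ v}.Nonempty := by
    by_contra hne
    have : convexHull ℝ V ⊆ {z | ψ z < ψ y} := by
      refine convexHull_min (fun v hv => ?_) (convex_halfSpace_lt ψ.isLinear _)
      rcases lt_trichotomy (ψ v) (ψ y) with h | h | h
      · exact h
      · exact (hxV ⟨v, hv, h⟩).elim
      · exact (hne ⟨v, hv, h⟩).elim
    exact lt_irrefl (ψ y) (this hy)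
  -- Among chords crossing the height `ψ y`, take one with the largest `u`-value there. Replacing
  -- one endpoint by `z` cannot increase this value, which says that `z` lies below the line `α + m
  -- ψ` through the chord.
  obtain ⟨⟨v, w⟩, ⟨⟨hv, hvy⟩, ⟨hw, hyw⟩⟩, hmax⟩ := Set.exists_max_image _
    (fun p : EuclideanSpace ℝ (Fin n) × EuclideanSpace ℝ (Fin n) =>
      (inner ℝ u p.1 * (ψ p.2 - ψ y) + inner ℝ u p.2 * (ψ y - ψ p.1)) / (ψ p.2 - ψ p.1))
    ((hV.subset (Set.sep_subset V fun v => ψ v < ψ y)).prod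
      (hV.subset (Set.sep_subset V fun v => ψ y < ψ v))) (hl.prod hr)
  simp only at hvy hyw hv hw hmax
  obtain ⟨m, hm⟩ : ∃ m, m = (inner ℝ u w - inner ℝ u v) / (ψ w - ψ v) := ⟨_, rfl⟩
  have hd : ψ w - ψ v ≠ 0 := by linarith
  rw [eq_div_iff hd] at hm
  have hval : (inner ℝ u v * (ψ w - ψ y) + inner ℝ u w * (ψ y - ψ v)) / (ψ w - ψ v) =
      inner ℝ u v - m * ψ v + m * ψ y := by
    rw [div_eq_iff hd]
    have : inner ℝ u w = inner ℝ u v + m * (ψ w - ψ v) := by linarith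
    rw [this]
    ring
  refine ⟨v, hv, w, hw, hvy, hyw, inner ℝ u v - m * ψ v, m, fun z hz => ?_, by ring, by linarith⟩
  rcases lt_trichotomy (ψ z) (ψ y) with h | h | h
  · have := hmax (z, w) ⟨⟨hz, h⟩, ⟨hw, hyw⟩⟩
    simp only at this
    rw [hval, div_le_iff₀ (by linarith)] at this
    have h2 : inner ℝ u w = inner ℝ u v - m * ψ v + m * ψ w := by linarith
    rw [h2] at this
    refine le_of_mul_le_mul_right ?_ (sub_pos.2 hyw)
    linarith
  · exact (hxV ⟨z, hz, h⟩).elim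
  · have := hmax (v, z) ⟨⟨hv, hvy⟩, ⟨hz, h⟩⟩
    simp only at this
    rw [hval, div_le_iff₀ (by linarith)] at this
    refine le_of_mul_le_mul_right ?_ (sub_pos.2 hvy)
    linarith

/-- Measurable sections of `ψ : K → ψ(K)`. -/
structure IsSection (ψ : EuclideanSpace ℝ (Fin n) →ₗ[ℝ] ℝ) (K : Set (EuclideanSpace ℝ (Fin n)))
    (s : ℝ → EuclideanSpace ℝ (Fin n)) : Prop where
  measurable : Measurable s
  mem : ∀ x ∈ ψ '' K, s x ∈ K
  map : ∀ x ∈ ψ '' K, ψ (s x) = x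

theorem mem_fiberPolytope {K : Set (EuclideanSpace ℝ (Fin n))} {z : EuclideanSpace ℝ (Fin n)} :
    z ∈ fiberPolytope ψ K ↔ ∃ s, IsSection ψ K s ∧ z = ∫ x in ψ '' K, s x :=
  ⟨fun ⟨s, hs, h, hz⟩ => ⟨s, ⟨hs, fun x hx => (h x hx).1, fun x hx => (h x hx).2⟩, hz⟩,
    fun ⟨s, hs, hz⟩ => ⟨s, hs.measurable, fun x hx => ⟨hs.mem x hx, hs.map x hx⟩, hz⟩⟩

/-- A polytope has finitely many measurable sections such that for every `u` one of them
maximizes `⟪u, ·⟫` on almost all fibers. -/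
theorem exists_maximal_sections {K : Set (EuclideanSpace ℝ (Fin n))} (hK : IsPolytope K)
    (ψ : EuclideanSpace ℝ (Fin n) →ₗ[ℝ] ℝ) :
    ∃ S : Set (ℝ → EuclideanSpace ℝ (Fin n)), S.Finite ∧ (∀ s ∈ S, IsSection ψ K s) ∧
      ∃ N : Set ℝ, N.Finite ∧ ∀ u : EuclideanSpace ℝ (Fin n), ∃ s ∈ S, ∀ y ∈ K, ψ y ∉ N →
        inner ℝ u y ≤ inner ℝ u (s (ψ y)) := by
  obtain ⟨V, hVne, rfl⟩ := hK
  set K := convexHull ℝ (V : Set (EuclideanSpace ℝ (Fin n))) with hK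
  -- The code of `x` is its position relative to all vertex heights. There are finitely many codes,
  -- so choosing a chord by code alone leaves finitely many candidate sections, all measurable.
  let code : ℝ → V → Prop × Prop := fun x v => (ψ v ≤ x, x ≤ ψ v)
  have hcode : Measurable code := by
    refine measurable_pi_lambda _ fun v => Measurable.prodMk ?_ ?_
    · exact measurableSet_setOfPred.1 measurableSet_Ici
    · exact measurableSet_setOfPred.1 measurableSet_Iic
  let sec : ((V → Prop × Prop) → V × V) → ℝ → EuclideanSpace ℝ (Fin n) :=
    fun c x => chord ψ (c (code x)).1 (c (code x)).2 x
  have hsec : ∀ c, Measurable (sec c) := fun c =>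
    (measurable_from_prod_countable_right (f := fun q : (V → Prop × Prop) × ℝ =>
      chord ψ (c q.1).1 (c q.1).2 q.2) fun k =>
      measurable_chord (c k).1.1 (c k).2.1).comp
      (hcode.prodMk measurable_id)
  refine ⟨{s | s ∈ Set.range sec ∧ IsSection ψ K s},
    (Set.finite_range sec).subset fun s hs => hs.1, fun s hs => hs.2, ψ '' V,
    V.finite_toSet.image _, fun u => ?_⟩
  have hex : ∀ k, ∃ p : V × V, ∀ x ∈ ψ '' K, code x = k → ψ p.1 ≤ x ∧ x ≤ ψ p.2 ∧
      (x ∉ ψ '' V → ψ p.1 < ψ p.2 ∧ ∃ α m : ℝ, (∀ z ∈ V, inner ℝ u z ≤ α + m * ψ z) ∧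
        inner ℝ u (p.1 : EuclideanSpace ℝ (Fin n)) = α + m * ψ p.1 ∧
        inner ℝ u (p.2 : EuclideanSpace ℝ (Fin n)) = α + m * ψ p.2) := by
    intro k
    by_cases h : ∃ x ∈ ψ '' K, code x = k
    · obtain ⟨x, hx, rfl⟩ := h
      have hcmp : ∀ x', code x' = code x → ∀ v : V, (ψ v ≤ x' ↔ ψ v ≤ x) ∧ (x' ≤ ψ v ↔ x ≤ ψ v) :=
        fun x' hx' v => ⟨(congrArg (fun c => (c v).1) hx').to_iff,
          (congrArg (fun c => (c v).2) hx').to_iff⟩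
      -- At a vertex height the constant chord suffices, as these heights are excluded from
      -- maximality. Elsewhere a supporting chord found at `x` serves every height with the same
      -- code.
      by_cases hxV : x ∈ ψ '' V
      · obtain ⟨v, hv, rfl⟩ := hxV
        refine ⟨⟨⟨v, hv⟩, ⟨v, hv⟩⟩, fun x' _ hx' => ?_⟩
        have h1 := hcmp x' hx' ⟨v, hv⟩
        have h2 := h1.1.2 le_rfl
        have h3 := h1.2.2 le_rfl
        exact ⟨h2, h3, fun h => (h ⟨v, hv, le_antisymm h2 h3⟩).elim⟩
      · obtain ⟨v, hv, w, hw, hvx, hxw, α, m, h⟩ :=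
          exists_supporting_chord V.finite_toSet hx hxV u
        exact ⟨⟨⟨v, hv⟩, ⟨w, hw⟩⟩, fun x' _ hx' => ⟨(hcmp x' hx' ⟨v, hv⟩).1.2 hvx.le,
          (hcmp x' hx' ⟨w, hw⟩).2.2 hxw.le, fun _ => ⟨hvx.trans hxw, α, m, h⟩⟩⟩
    · obtain ⟨v, hv⟩ := hVne
      exact ⟨⟨⟨v, hv⟩, ⟨v, hv⟩⟩, fun x hx hk => (h ⟨x, hx, hk⟩).elim⟩
  choose c hc using hex
  refine ⟨sec c, ⟨⟨c, rfl⟩, hsec c, fun x hx => ?_, fun x hx => ?_⟩, fun y hy hyN => ?_⟩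
  · obtain ⟨h1, h2, -⟩ := hc _ x hx rfl
    exact (convex_convexHull ℝ _).segment_subset (subset_convexHull ℝ _ (c (code x)).1.2)
      (subset_convexHull ℝ _ (c (code x)).2.2) (chord_mem_segment h1 h2)
  · obtain ⟨h1, h2, -⟩ := hc _ x hx rfl
    exact map_chord h1 h2
  · obtain ⟨h1, h2, h3⟩ := hc _ (ψ y) ⟨y, hy, rfl⟩ rfl
    obtain ⟨hlt, α, m, hall, hv, hw⟩ := h3 hyN
    have hy' : inner ℝ u y ≤ α + m * ψ y := by
      have : K ⊆ {z | inner ℝ u z - m * ψ z ≤ α} :=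
        convexHull_min (fun z hz => by
          have := hall z hz
          simp only [Set.mem_ofPred_eq]
          linarith)
          (convex_halfSpace_le (f := fun z => inner ℝ u z - m * ψ z)
            ((innerₛₗ ℝ u - m • ψ : EuclideanSpace ℝ (Fin n) →ₗ[ℝ] ℝ).isLinear) α)
      have := this hy
      simp only [Set.mem_ofPred_eq] at this
      linarith
    refine hy'.trans_eq ?_
    have hd : ψ (c (code (ψ y))).2 - ψ (c (code (ψ y))).1 ≠ 0 := (sub_pos.2 hlt).ne'
    simp only [sec, chord, inner_add_right, inner_smul_right, inner_sub_right, hv, hw]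
    field_simp
    ring

theorem IsPolytope.measurableSet_image {K : Set (EuclideanSpace ℝ (Fin n))} (hK : IsPolytope K)
    (ψ : EuclideanSpace ℝ (Fin n) →ₗ[ℝ] ℝ) : MeasurableSet (ψ '' K) :=
  (hK.isCompact.image ψ.continuous_of_finiteDimensional).measurableSet

theorem IsSection.integrableOn {K : Set (EuclideanSpace ℝ (Fin n))}
    {s : ℝ → EuclideanSpace ℝ (Fin n)} (hs : IsSection ψ K s) (hK : IsPolytope K) :
    IntegrableOn s (ψ '' K) := by
  obtain ⟨B, hB⟩ := hK.isCompact.isBounded.exists_norm_le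
  refine Measure.integrableOn_of_bounded (M := B)
    (hK.isCompact.image ψ.continuous_of_finiteDimensional).measure_lt_top.ne
    hs.measurable.aestronglyMeasurable ?_
  filter_upwards [ae_restrict_mem (hK.measurableSet_image ψ)] with x hx
  exact hB _ (hs.mem x hx)

/-- If a section is dominated by another one in direction `u` on almost all fibers, then so are
the integrals. -/
theorem IsSection.inner_integral_le {K : Set (EuclideanSpace ℝ (Fin n))}
    {s t : ℝ → EuclideanSpace ℝ (Fin n)} (hs : IsSection ψ K s) (ht : IsSection ψ K t)
    (hK : IsPolytope K) {N : Set ℝ} (hN : N.Finite) {u : EuclideanSpace ℝ (Fin n)}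
    (h : ∀ x ∈ ψ '' K, x ∉ N → inner ℝ u (s x) ≤ inner ℝ u (t x)) :
    inner ℝ u (∫ x in ψ '' K, s x) ≤ inner ℝ u (∫ x in ψ '' K, t x) := by
  rw [← integral_inner (hs.integrableOn hK), ← integral_inner (ht.integrableOn hK)]
  refine integral_mono_ae ((hs.integrableOn hK).const_inner u)
    ((ht.integrableOn hK).const_inner u) ?_
  filter_upwards [ae_restrict_mem (hK.measurableSet_image ψ),
    ae_restrict_of_ae (hN.countable.ae_notMem volume)] with x hx hxN
  exact h x hx hxN

theorem convex_fiberPolytope {K : Set (EuclideanSpace ℝ (Fin n))} (hK : IsPolytope K) :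
    Convex ℝ (fiberPolytope ψ K) := by
  intro y hy z hz a b ha hb hab
  obtain ⟨s, hs, rfl⟩ := mem_fiberPolytope.1 hy
  obtain ⟨t, ht, rfl⟩ := mem_fiberPolytope.1 hz
  refine mem_fiberPolytope.2 ⟨fun x => a • s x + b • t x, ⟨?_, fun x hx => ?_, fun x hx => ?_⟩, ?_⟩
  · exact (hs.measurable.const_smul a).add (ht.measurable.const_smul b)
  · exact hK.convex (hs.mem x hx) (ht.mem x hx) ha hb hab
  · rw [map_add, map_smul, map_smul, hs.map x hx, ht.map x hx, ← add_smul, hab, one_smul]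
  · rw [← integral_smul, ← integral_smul]
    exact (integral_add ((hs.integrableOn hK).smul a) ((ht.integrableOn hK).smul b)).symm

/-- The fiber polytope of a polytope is a polytope. -/
theorem IsPolytope.fiberPolytope {K : Set (EuclideanSpace ℝ (Fin n))} (hK : IsPolytope K)
    (ψ : EuclideanSpace ℝ (Fin n) →ₗ[ℝ] ℝ) : IsPolytope (fiberPolytope ψ K) := by
  obtain ⟨S, hSf, hS, N, hN, hmax⟩ := exists_maximal_sections hK ψ
  have hfin := hSf.image fun s => ∫ x in ψ '' K, s x
  refine isPolytope_iff.2 ⟨_, hfin, ?_, Set.Subset.antisymm (fun z hz => ?_) ?_⟩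
  · obtain ⟨s, hs, -⟩ := hmax 0
    exact ⟨_, s, hs, rfl⟩
  · obtain ⟨s, hs, rfl⟩ := mem_fiberPolytope.1 hz
    -- By separation it suffices to dominate the integral in each direction `u`; the `u`-maximal
    -- section in `S` does so.
    refine mem_of_forall_inner_le (hfin.isCompact_convexHull ℝ) (convex_convexHull ℝ _) fun u => ?_
    obtain ⟨t, ht, htu⟩ := hmax u
    refine ⟨_, subset_convexHull ℝ _ ⟨t, ht, rfl⟩,
      hs.inner_integral_le (hS t ht) hK hN fun x hx hxN => ?_⟩
    have := htu (s x) (hs.mem x hx)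
    rw [hs.map x hx] at this
    exact this hxN
  · refine convexHull_min ?_ (convex_fiberPolytope hK)
    rintro _ ⟨s, hs, rfl⟩
    exact mem_fiberPolytope.2 ⟨s, hS s hs, rfl⟩

theorem IsPolytope.exists_image_eq_Icc {K : Set (EuclideanSpace ℝ (Fin n))} (hK : IsPolytope K)
    (ψ : EuclideanSpace ℝ (Fin n) →ₗ[ℝ] ℝ) : ∃ a b : ℝ, a ≤ b ∧ ψ '' K = Set.Icc a b := by
  have hc : IsCompact (ψ '' K) := hK.isCompact.image ψ.continuous_of_finiteDimensional
  have hn : (ψ '' K).Nonempty := hK.nonempty.image _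
  have h := eq_Icc_of_connected_compact
    ⟨hn, (hK.convex.linear_image ψ).isPreconnected⟩ hc
  exact ⟨_, _, Set.nonempty_Icc.1 (h ▸ hn), h⟩

theorem setIntegral_Icc_eq {f : ℝ → EuclideanSpace ℝ (Fin n)} {a b : ℝ} (hab : a ≤ b) :
    ∫ x in Set.Icc a b, f x = ∫ x in a..b, f x := by
  rw [integral_Icc_eq_integral_Ioc, intervalIntegral.integral_of_le hab]

theorem le_of_image_eq_Icc {K : Set (EuclideanSpace ℝ (Fin n))} (hK : IsPolytope K) {a b : ℝ}
    (h : ψ '' K = Set.Icc a b) : a ≤ b :=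
  Set.nonempty_Icc.1 (h ▸ hK.nonempty.image ψ)

/-! ### Translations and dilations of fiber polytopes. -/

section Translate

variable {K : Set (EuclideanSpace ℝ (Fin n))} {a b : ℝ}

theorem image_add_singleton (h : ψ '' K = Set.Icc a b) (e : EuclideanSpace ℝ (Fin n)) :
    ψ '' (K + {e}) = Set.Icc (a + ψ e) (b + ψ e) := by
  rw [Set.image_add, h, Set.image_singleton, Set.add_singleton, Set.image_add_const_Icc]

/-- Translating a section by `e` adds the constant `e` to an integral over an interval of length `b
- a`. The reverse inclusion will come from translating back by `-e`. -/
theorem add_singleton_subset_fiberPolytope (hK : IsPolytope K) (h : ψ '' K = Set.Icc a b)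
    (e : EuclideanSpace ℝ (Fin n)) :
    fiberPolytope ψ K + {(b - a) • e} ⊆ fiberPolytope ψ (K + {e}) := by
  have hab := le_of_image_eq_Icc hK h
  rw [Set.add_singleton]
  rintro _ ⟨z, hz, rfl⟩
  obtain ⟨s, hs, rfl⟩ := mem_fiberPolytope.1 hz
  have hmem : ∀ x ∈ ψ '' (K + {e}), x - ψ e ∈ ψ '' K := by
    intro x hx
    rw [image_add_singleton h] at hx
    rw [h]
    exact ⟨by linarith [hx.1], by linarith [hx.2]⟩
  refine mem_fiberPolytope.2 ⟨fun x => s (x - ψ e) + e, ⟨?_, fun x hx => ?_, fun x hx => ?_⟩, ?_⟩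
  · exact (hs.measurable.comp (measurable_id.sub_const _)).add_const e
  · exact Set.add_mem_add (hs.mem _ (hmem x hx)) rfl
  · rw [map_add, hs.map _ (hmem x hx), sub_add_cancel]
  · have hint : IntervalIntegrable s volume a b := by
      rw [intervalIntegrable_iff_integrableOn_Icc_of_le hab, ← h]
      exact hs.integrableOn hK
    rw [image_add_singleton h, h, setIntegral_Icc_eq hab, setIntegral_Icc_eq (by linarith),
      intervalIntegral.integral_comp_sub_right (fun x => s x + e) (ψ e), add_sub_cancel_right,
      add_sub_cancel_right, intervalIntegral.integral_add hint (by simp),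
      intervalIntegral.integral_const]

theorem fiberPolytope_add_singleton (hK : IsPolytope K) (h : ψ '' K = Set.Icc a b)
    (e : EuclideanSpace ℝ (Fin n)) :
    fiberPolytope ψ (K + {e}) = fiberPolytope ψ K + {(b - a) • e} := by
  refine Set.Subset.antisymm (fun z hz => ?_) (add_singleton_subset_fiberPolytope hK h e)
  have := add_singleton_subset_fiberPolytope (hK.add (.singleton e)) (image_add_singleton h e) (-e)
    (Set.add_mem_add hz rfl)
  rw [add_assoc, Set.singleton_add_singleton, add_neg_cancel, Set.singleton_zero, add_zero] at this
  refine ⟨_, this, _, rfl, ?_⟩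
  simp

theorem image_smul_eq_Icc (h : ψ '' K = Set.Icc a b) {c : ℝ} (hc : 0 < c) :
    ψ '' (c • K) = Set.Icc (c * a) (c * b) := by
  rw [image_smul_set, h]
  simp only [← Set.image_smul, smul_eq_mul]
  exact Set.image_mul_left_Icc' hc a b

/-- One factor `c` comes from the values of the section, the other from the change of variable.
Applied to `c⁻¹`, this also gives the reverse inclusion. -/
theorem smul_subset_fiberPolytope (hK : IsPolytope K) {c : ℝ} (hc : 0 < c) :
    c ^ 2 • fiberPolytope ψ K ⊆ fiberPolytope ψ (c • K) := by
  obtain ⟨a, b, hab, h⟩ := hK.exists_image_eq_Icc ψ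
  rintro _ ⟨z, hz, rfl⟩
  obtain ⟨s, hs, rfl⟩ := mem_fiberPolytope.1 hz
  have hmem : ∀ x ∈ ψ '' (c • K), x / c ∈ ψ '' K := by
    rintro _ ⟨_, ⟨y, hy, rfl⟩, rfl⟩
    exact ⟨y, hy, by simp [mul_div_cancel_left₀ _ hc.ne']⟩
  refine mem_fiberPolytope.2 ⟨fun x => c • s (x / c), ⟨?_, fun x hx => ?_, fun x hx => ?_⟩, ?_⟩
  · exact (hs.measurable.comp (measurable_id.div_const c)).const_smul c
  · exact Set.smul_mem_smul_set (hs.mem _ (hmem x hx))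
  · rw [map_smul, hs.map _ (hmem x hx), smul_eq_mul, mul_div_cancel₀ _ hc.ne']
  · rw [image_smul_eq_Icc h hc, h, setIntegral_Icc_eq hab,
      setIntegral_Icc_eq (mul_le_mul_of_nonneg_left hab hc.le), intervalIntegral.integral_smul,
      intervalIntegral.integral_comp_div _ hc.ne', mul_div_cancel_left₀ _ hc.ne',
      mul_div_cancel_left₀ _ hc.ne', smul_smul, sq]

theorem fiberPolytope_smul (hK : IsPolytope K) {c : ℝ} (hc : 0 < c) :
    fiberPolytope ψ (c • K) = c ^ 2 • fiberPolytope ψ K := by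
  refine Set.Subset.antisymm (fun z hz => ?_) (smul_subset_fiberPolytope hK hc)
  have := smul_subset_fiberPolytope (hK.smul c) (inv_pos.2 hc) (Set.smul_mem_smul_set hz)
  rw [smul_smul, inv_mul_cancel₀ hc.ne', one_smul, inv_pow] at this
  exact (Set.mem_smul_set_iff_inv_smul_mem₀ (pow_pos hc 2).ne' _ _).2 this

end Translate

/-! ### Adding a segment: cut and insert. -/

/-- The projection onto `ker ψ` along `δ`, if `ψ δ = 1`. -/
noncomputable def projAlong (ψ : EuclideanSpace ℝ (Fin n) →ₗ[ℝ] ℝ)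
    (δ : EuclideanSpace ℝ (Fin n)) : EuclideanSpace ℝ (Fin n) →ₗ[ℝ] EuclideanSpace ℝ (Fin n) :=
  LinearMap.id - ψ.smulRight δ

theorem projAlong_apply (δ x : EuclideanSpace ℝ (Fin n)) :
    projAlong ψ δ x = x - ψ x • δ := rfl

/-- The section obtained from `s` by cutting it at height `t` and inserting a path of length `l`
in direction `δ` which starts at `q`. -/
noncomputable def insertSegment (s : ℝ → EuclideanSpace ℝ (Fin n))
    (q δ : EuclideanSpace ℝ (Fin n)) (t l : ℝ) (x : ℝ) : EuclideanSpace ℝ (Fin n) :=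
  if x ≤ t then s x else if x ≤ t + l then q + (x - t) • δ else s (x - l) + l • δ

section InsertSegment

variable {K : Set (EuclideanSpace ℝ (Fin n))} {a b : ℝ} {δ : EuclideanSpace ℝ (Fin n)} {l : ℝ}

theorem mem_add_segment (hl : 0 ≤ l) {y : EuclideanSpace ℝ (Fin n)} :
    y ∈ K + segment ℝ 0 (l • δ) ↔ ∃ k ∈ K, ∃ r, 0 ≤ r ∧ r ≤ l ∧ y = k + r • δ := by
  rw [segment_eq_image']
  constructor
  · rintro ⟨k, hk, _, ⟨θ, ⟨h0, h1⟩, rfl⟩, rfl⟩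
    refine ⟨k, hk, θ * l, by positivity, by nlinarith, ?_⟩
    simp [smul_smul]
  · rintro ⟨k, hk, r, h0, h1, rfl⟩
    refine ⟨k, hk, _, ⟨r / l, ⟨by positivity, div_le_one_of_le₀ h1 hl⟩, rfl⟩, ?_⟩
    rcases hl.eq_or_lt with rfl | hl
    · simp [le_antisymm h1 h0]
    · simp [smul_smul, div_mul_cancel₀ _ hl.ne']

theorem image_add_segment (hab : a ≤ b) (h : ψ '' K = Set.Icc a b) (hδ : ψ δ = 1) (hl : 0 ≤ l) :
    ψ '' (K + segment ℝ 0 (l • δ)) = Set.Icc a (b + l) := by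
  have hseg : ψ '' segment ℝ 0 (l • δ) = segment ℝ (ψ 0) (ψ (l • δ)) :=
    image_segment ℝ ψ.toAffineMap _ _
  rw [Set.image_add, h, hseg, map_zero, map_smul, hδ, smul_eq_mul, mul_one,
    segment_eq_Icc hl, Set.Icc_add_Icc hab hl, add_zero]

/-- Sections need only be measurable, so the cut at height `ψ q` may jump: `s (ψ q) = q` is not
required. -/
theorem isSection_insertSegment {s : ℝ → EuclideanSpace ℝ (Fin n)} (hs : IsSection ψ K s)
    (hab : a ≤ b) (h : ψ '' K = Set.Icc a b) (hδ : ψ δ = 1) (hl : 0 ≤ l)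
    {q : EuclideanSpace ℝ (Fin n)} (hq : q ∈ K) :
    IsSection ψ (K + segment ℝ 0 (l • δ)) (insertSegment s q δ (ψ q) l) := by
  have hqI : ψ q ∈ Set.Icc a b := h ▸ ⟨q, hq, rfl⟩
  have aux : ∀ x ∈ Set.Icc a (b + l), insertSegment s q δ (ψ q) l x ∈ K + segment ℝ 0 (l • δ) ∧
      ψ (insertSegment s q δ (ψ q) l x) = x := by
    intro x hx
    unfold insertSegment
    split_ifs with h1 h2
    · have hx' : x ∈ ψ '' K := by
        rw [h]
        exact ⟨hx.1, h1.trans hqI.2⟩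
      exact ⟨(mem_add_segment hl).2 ⟨_, hs.mem x hx', 0, le_rfl, hl, by simp⟩, hs.map x hx'⟩
    · exact ⟨(mem_add_segment hl).2 ⟨_, hq, _, by linarith, by linarith, rfl⟩, by simp [hδ]⟩
    · have hx' : x - l ∈ ψ '' K := by
        rw [h]
        exact ⟨by linarith [hqI.1], by linarith [hx.2]⟩
      exact ⟨(mem_add_segment hl).2 ⟨_, hs.mem _ hx', _, hl, le_rfl, rfl⟩,
        by simp [hδ, hs.map _ hx']⟩
  refine ⟨?_, fun x hx => (aux x ?_).1, fun x hx => (aux x ?_).2⟩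
  · have := hs.measurable
    unfold insertSegment
    refine Measurable.ite measurableSet_Iic this (Measurable.ite measurableSet_Iic ?_ ?_)
    · fun_prop
    · fun_prop
  all_goals rwa [image_add_segment hab h hδ hl] at hx

/-- With `t = ψ q`, the inserted piece contributes `l q + (l²/2) δ` and the shift above it `(b - t)
l δ`. The terms in `t` combine with `l q` to the projection of `q`, so the remaining vector does not
depend on `q`. -/
theorem integral_insertSegment {s : ℝ → EuclideanSpace ℝ (Fin n)} (hs : IsSection ψ K s)
    (hK : IsPolytope K) (h : ψ '' K = Set.Icc a b) (hδ : ψ δ = 1) (hl : 0 ≤ l)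
    {q : EuclideanSpace ℝ (Fin n)} (hq : q ∈ K) :
    ∫ x in ψ '' (K + segment ℝ 0 (l • δ)), insertSegment s q δ (ψ q) l x =
      (∫ x in ψ '' K, s x) + l • projAlong ψ δ q + (l * b + l ^ 2 / 2) • δ := by
  have hab := le_of_image_eq_Icc hK h
  have hqI : ψ q ∈ Set.Icc a b := h ▸ ⟨q, hq, rfl⟩
  have hseg : IsPolytope (segment ℝ 0 (l • δ)) :=
    isPolytope_iff.2 ⟨{0, l • δ}, by simp, by simp, (convexHull_pair _ _).symm⟩
  have hint := (isSection_insertSegment hs hab h hδ hl hq).integrableOn (hK.add hseg)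
  rw [image_add_segment hab h hδ hl] at hint ⊢
  have hsint := hs.integrableOn hK
  rw [h] at hsint ⊢
  obtain ⟨t, ht⟩ : ∃ t, t = ψ q := ⟨_, rfl⟩
  rw [← ht] at hint hqI ⊢
  obtain ⟨hat, htb⟩ := hqI
  have sub : ∀ c d, a ≤ c → c ≤ d → d ≤ b + l →
      IntervalIntegrable (insertSegment s q δ t l) volume c d := fun c d h1 h2 h3 => by
    rw [intervalIntegrable_iff_integrableOn_Icc_of_le h2]
    exact hint.mono_set (Set.Icc_subset_Icc h1 h3)
  have sub' : ∀ c d, a ≤ c → c ≤ d → d ≤ b → IntervalIntegrable s volume c d :=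
    fun c d h1 h2 h3 => by
    rw [intervalIntegrable_iff_integrableOn_Icc_of_le h2]
    exact hsint.mono_set (Set.Icc_subset_Icc h1 h3)
  have e1 : ∫ x in a..t, insertSegment s q δ t l x = ∫ x in a..t, s x := by
    refine intervalIntegral.integral_congr_ae (Filter.Eventually.of_forall fun x hx => ?_)
    rw [Set.uIoc_of_le hat] at hx
    simp [insertSegment, hx.2]
  have e2 : ∫ x in t..(t + l), insertSegment s q δ t l x = l • q + (l ^ 2 / 2) • δ := by
    have : ∫ x in t..(t + l), insertSegment s q δ t l x = ∫ x in t..(t + l), (q + (x - t) • δ) := by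
      refine intervalIntegral.integral_congr_ae (Filter.Eventually.of_forall fun x hx => ?_)
      rw [Set.uIoc_of_le (by linarith)] at hx
      simp [insertSegment, hx.2, hx.1]
    rw [this, intervalIntegral.integral_comp_sub_right (fun x => q + x • δ) t,
      intervalIntegral.integral_add (by simp)
        (Continuous.intervalIntegrable (by fun_prop) _ _),
      intervalIntegral.integral_const, intervalIntegral.integral_smul_const, integral_id]
    simp
  have e3 : ∫ x in (t + l)..(b + l), insertSegment s q δ t l x =
      (∫ x in t..b, s x) + ((b - t) * l) • δ := by
    have : ∫ x in (t + l)..(b + l), insertSegment s q δ t l x =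
        ∫ x in (t + l)..(b + l), (s (x - l) + l • δ) := by
      refine intervalIntegral.integral_congr_ae (Filter.Eventually.of_forall fun x hx => ?_)
      rw [Set.uIoc_of_le (by linarith)] at hx
      have h1 : ¬ x ≤ t := by linarith [hx.1]
      simp [insertSegment, h1, hx.1]
    rw [this, intervalIntegral.integral_comp_sub_right (fun x => s x + l • δ) l,
      add_sub_cancel_right, add_sub_cancel_right,
      intervalIntegral.integral_add (sub' _ _ hat htb le_rfl) (by simp),
      intervalIntegral.integral_const, smul_smul]
  rw [setIntegral_Icc_eq hab, setIntegral_Icc_eq (by linarith),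
    ← intervalIntegral.integral_add_adjacent_intervals (b := t) (sub _ _ le_rfl hat (by linarith))
      (sub _ _ hat (by linarith) le_rfl),
    ← intervalIntegral.integral_add_adjacent_intervals (a := t) (b := t + l)
      (sub _ _ hat (by linarith) (by linarith)) (sub _ _ (by linarith) (by linarith) le_rfl),
    e1, e2, e3, ← intervalIntegral.integral_add_adjacent_intervals (b := t)
      (sub' _ _ le_rfl hat htb) (sub' _ _ hat htb le_rfl), projAlong_apply, ← ht]
  module

/-- The fiber polytope of the sum of a polytope and a segment. -/
theorem fiberPolytope_add_segment (hK : IsPolytope K) (h : ψ '' K = Set.Icc a b) (hδ : ψ δ = 1)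
    (hl : 0 ≤ l) :
    fiberPolytope ψ (K + segment ℝ 0 (l • δ)) =
      fiberPolytope ψ K + l • (projAlong ψ δ '' K) + {(l * b + l ^ 2 / 2) • δ} := by
  have hab := le_of_image_eq_Icc hK h
  have hseg : IsPolytope (segment ℝ 0 (l • δ)) :=
    isPolytope_iff.2 ⟨{0, l • δ}, by simp, by simp, (convexHull_pair _ _).symm⟩
  have hR := ((hK.fiberPolytope ψ).add ((hK.image (projAlong ψ δ)).smul l)).add
    (.singleton ((l * b + l ^ 2 / 2) • δ))
  have hins : ∀ s, IsSection ψ K s → ∀ q ∈ K,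
      (∫ x in ψ '' (K + segment ℝ 0 (l • δ)), insertSegment s q δ (ψ q) l x) ∈
        fiberPolytope ψ K + l • (projAlong ψ δ '' K) + {(l * b + l ^ 2 / 2) • δ} := by
    intro s hs q hq
    rw [integral_insertSegment hs hK h hδ hl hq]
    exact Set.add_mem_add (Set.add_mem_add (mem_fiberPolytope.2 ⟨s, hs, rfl⟩)
      (Set.smul_mem_smul_set ⟨q, hq, rfl⟩)) rfl
  refine Set.Subset.antisymm (fun z hz => ?_) ?_
  · obtain ⟨σ, hσ, rfl⟩ := mem_fiberPolytope.1 hz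
    refine mem_of_forall_inner_le hR.isCompact hR.convex fun u => ?_
    obtain ⟨S, -, hS, N, hN, hmax⟩ := exists_maximal_sections hK ψ
    obtain ⟨s, hsS, hs⟩ := hmax u
    obtain ⟨q, hq, hqmax⟩ := hK.isCompact.exists_isMaxOn hK.nonempty
      (f := fun y => inner ℝ u (projAlong ψ δ y))
      (continuous_const.inner (projAlong ψ δ).continuous_of_finiteDimensional).continuousOn
    replace hqmax : ∀ y ∈ K, inner ℝ u (projAlong ψ δ y) ≤ inner ℝ u (projAlong ψ δ q) :=
      fun y hy => hqmax hy
    -- The competitor is the `u`-maximal section cut at a point `q` whose projection is `u`-maximal.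
    -- Its upper piece evaluates `s` at `x - l`, hence the shifted copy of `N` among the exceptional
    -- heights.
    refine ⟨_, hins s (hS s hsS) q hq, hσ.inner_integral_le
      (isSection_insertSegment (hS s hsS) hab h hδ hl hq) (hK.add hseg)
      (hN.union (hN.image fun x => x + l)) fun x hx hxN => ?_⟩
    obtain ⟨k, hk, r, hr0, hrl, hkr⟩ := (mem_add_segment hl).1 (hσ.mem x hx)
    have hψk : ψ k + r = x := by
      rw [← hσ.map x hx, hkr, map_add, map_smul, hδ, smul_eq_mul, mul_one]
    have hσx : inner ℝ u (σ x) = inner ℝ u (projAlong ψ δ k) + x * inner ℝ u δ := by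
      rw [hkr, projAlong_apply, ← hψk]
      simp only [inner_add_right, inner_sub_right, inner_smul_right]
      ring
    -- Moving from `k` towards `q` stays in `K` and never lowers the `u`-value of the projection
    -- below its value at `k`.
    have seg : ∀ y ∈ segment ℝ k q,
        y ∈ K ∧ inner ℝ u (projAlong ψ δ k) ≤ inner ℝ u (projAlong ψ δ y) := by
      intro y hy
      refine ⟨hK.convex.segment_subset hk hq hy, ?_⟩
      have hconv : Convex ℝ {y | inner ℝ u (projAlong ψ δ k) ≤ inner ℝ u (projAlong ψ δ y)} :=
        convex_halfSpace_ge (f := fun y => inner ℝ u (projAlong ψ δ y))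
          (innerₛₗ ℝ u ∘ₗ projAlong ψ δ).isLinear _
      exact hconv.segment_subset (le_refl (inner ℝ u (projAlong ψ δ k))) (hqmax k hk) hy
    have key : ∀ y ∈ K, ψ y ∉ N → inner ℝ u (projAlong ψ δ k) ≤ inner ℝ u (projAlong ψ δ y) →
        inner ℝ u (projAlong ψ δ k) + ψ y * inner ℝ u δ ≤ inner ℝ u (s (ψ y)) := by
      intro y hy hyN hle
      have := hs y hy hyN
      simp only [projAlong_apply, inner_sub_right, inner_smul_right] at hle ⊢
      linarith
    rw [hσx]
    unfold insertSegment
    split_ifs with h1 h2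
    -- Below the cut, `[k, q]` has a point at height `x`, and `s` dominates it.
    · have hkx : ψ k ≤ x := by linarith
      obtain ⟨hyK, hy⟩ := seg _ (chord_mem_segment hkx h1)
      have := key _ hyK (by rw [map_chord hkx h1]; exact fun h => hxN (Or.inl h)) hy
      rwa [map_chord hkx h1] at this
    · have := hqmax k hk
      simp only [projAlong_apply, inner_add_right, inner_sub_right, inner_smul_right] at this ⊢
      linarith
    · have hxq : ψ q ≤ x - l := by linarith
      -- Since `r ≤ l`, the height `x - l` lies between those of `q` and `k`, so `[k, q]` supplies a
      -- point there.
      have hkx : x - l ≤ ψ k := by linarith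
      have hyseg := chord_mem_segment hxq hkx
      rw [segment_symm] at hyseg
      obtain ⟨hyK, hy⟩ := seg _ hyseg
      have := key _ hyK (by
        rw [map_chord hxq hkx]
        exact fun h => hxN (Or.inr ⟨_, h, by simp⟩)) hy
      rw [map_chord hxq hkx] at this
      rw [inner_add_right, inner_smul_right]
      linarith
  · rintro _ ⟨_, ⟨z, hz, _, ⟨_, ⟨q, hq, rfl⟩, rfl⟩, rfl⟩, _, rfl, rfl⟩
    obtain ⟨s, hs, rfl⟩ := mem_fiberPolytope.1 hz
    exact mem_fiberPolytope.2 ⟨_, isSection_insertSegment hs hab h hδ hl hq,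
      (integral_insertSegment hs hK h hδ hl hq).symm⟩

end InsertSegment

/-! ### Mixed fiber polytopes with a segment, and their faces. -/

/-- The multiple of the projection along `d₁ - d₀` which has no denominators. -/
noncomputable def projEdge (ψ : EuclideanSpace ℝ (Fin n) →ₗ[ℝ] ℝ)
    (d₀ d₁ : EuclideanSpace ℝ (Fin n)) :
    EuclideanSpace ℝ (Fin n) →ₗ[ℝ] EuclideanSpace ℝ (Fin n) :=
  (ψ d₁ - ψ d₀) • LinearMap.id - ψ.smulRight (d₁ - d₀)

theorem projEdge_apply (d₀ d₁ x : EuclideanSpace ℝ (Fin n)) :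
    projEdge ψ d₀ d₁ x = (ψ d₁ - ψ d₀) • x - ψ x • (d₁ - d₀) := rfl

/-- The mixed fiber polytope of a polytope and a segment is, up to translation, a multiple of the
projection of the polytope along the segment. -/
theorem isMixedFiberPolytope_segment {C : Set (EuclideanSpace ℝ (Fin n))} (hC : IsPolytope C)
    {a b : ℝ} (h : ψ '' C = Set.Icc a b) {d₀ d₁ : EuclideanSpace ℝ (Fin n)}
    (hd : ψ d₀ < ψ d₁) :
    IsMixedFiberPolytope ψ C (segment ℝ d₀ d₁)
      (projEdge ψ d₀ d₁ '' C + {b • d₁ - a • d₀}) := by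
  have hab := le_of_image_eq_Icc hC h
  obtain ⟨L, hL⟩ : ∃ L, L = ψ d₁ - ψ d₀ := ⟨_, rfl⟩
  have hL0 : 0 < L := hL ▸ sub_pos.2 hd
  obtain ⟨δ, hδ⟩ : ∃ δ, δ = L⁻¹ • (d₁ - d₀) := ⟨_, rfl⟩
  have hLδ : L • δ = d₁ - d₀ := by rw [hδ, smul_smul, mul_inv_cancel₀ hL0.ne', one_smul]
  have hψδ : ψ δ = 1 := by
    rw [hδ, map_smul, map_sub, ← hL, smul_eq_mul, inv_mul_cancel₀ hL0.ne']
  -- The coefficient of `l₂²` is the fiber polytope of the segment: its length `L` under `ψ` times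
  -- its midpoint.
  refine ⟨(hC.image _).add (.singleton _), fiberPolytope ψ C, {(L / 2) • (d₀ + d₁)},
    hC.fiberPolytope ψ, .singleton _, fun l₁ l₂ h₁ h₂ => ?_⟩
  have hl : 0 ≤ l₂ * L := (mul_pos h₂ hL0).le
  have hseg : l₂ • segment ℝ d₀ d₁ = segment ℝ 0 ((l₂ * L) • δ) + {l₂ • d₀} := by
    rw [mul_smul, hLδ, ← convexHull_pair, ← convexHull_pair, ← convexHull_smul,
      ← convexHull_singleton (𝕜 := ℝ) (l₂ • d₀), ← convexHull_add]
    congr 1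
    simp [← Set.image_smul, Set.image_insert_eq, smul_sub]
  have hK := hC.smul l₁
  have hKI := image_smul_eq_Icc h h₁
  have hS : IsPolytope (segment ℝ 0 ((l₂ * L) • δ)) :=
    isPolytope_iff.2 ⟨{0, (l₂ * L) • δ}, by simp, by simp, (convexHull_pair _ _).symm⟩
  have himg : (l₂ * L) • (projAlong ψ δ '' (l₁ • C)) =
      (l₁ * l₂) • (projEdge ψ d₀ d₁ '' C) := by
    simp only [← Set.image_smul, Set.image_image]
    refine Set.image_congr fun x _ => ?_
    rw [projAlong_apply, projEdge_apply, ← hLδ, ← hL, map_smul, smul_eq_mul]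
    module
  rw [hseg, ← add_assoc, fiberPolytope_add_singleton (hK.add hS)
      (image_add_segment (le_of_image_eq_Icc hK hKI) hKI hψδ hl),
    fiberPolytope_add_segment hK hKI hψδ hl, fiberPolytope_smul hC h₁, himg, smul_add]
  simp only [add_assoc, Set.smul_set_singleton, Set.singleton_add_singleton]
  -- Only the translation vectors remain to be compared.
  congr 3
  have hd₁ : d₁ = d₀ + L • δ := by rw [hLδ]; abel
  rw [hd₁]
  module

/-- A one-dimensional polytope with one-dimensional image is a segment. -/
theorem IsPolytope.eq_segment {D : Set (EuclideanSpace ℝ (Fin n))} (hD : IsPolytope D)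
    (h₁ : affDim D = 1) (h₂ : affDim (ψ '' D) = 1) :
    ∃ d₀ ∈ D, ∃ d₁ ∈ D, ψ d₀ < ψ d₁ ∧ D = segment ℝ d₀ d₁ := by
  obtain ⟨a, b, hab, h⟩ := hD.exists_image_eq_Icc ψ
  have hlt : a < b := by
    refine hab.lt_of_ne ?_
    rintro rfl
    rw [affDim, h, Set.Icc_self, vectorSpan_singleton, finrank_bot] at h₂
    exact zero_ne_one h₂
  obtain ⟨d₀, hd₀, rfl⟩ : a ∈ ψ '' D := h ▸ Set.left_mem_Icc.2 hab
  obtain ⟨d₁, hd₁, rfl⟩ : b ∈ ψ '' D := h ▸ Set.right_mem_Icc.2 hab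
  refine ⟨d₀, hd₀, d₁, hd₁, hlt, Set.Subset.antisymm (fun y hy => ?_)
    (hD.convex.segment_subset hd₀ hd₁)⟩
  -- The vector `d₁ - d₀` spans the direction of `D`; applying `ψ` shows that the coefficient of `y
  -- - d₀` lies in `[0, 1]`.
  have hne : (⟨d₁ - d₀, vsub_mem_vectorSpan ℝ hd₁ hd₀⟩ : vectorSpan ℝ D) ≠ 0 := by
    intro h0
    have := congrArg ψ (congrArg Subtype.val h0)
    simp only [map_sub, ZeroMemClass.coe_zero, map_zero] at this
    linarith
  obtain ⟨c, hc⟩ := (finrank_eq_one_iff_of_nonzero' _ hne).1 h₁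
    ⟨y - d₀, vsub_mem_vectorSpan ℝ hy hd₀⟩
  replace hc : c • (d₁ - d₀) = y - d₀ := congrArg Subtype.val hc
  have hψ : c * (ψ d₁ - ψ d₀) = ψ y - ψ d₀ := by
    simpa using congrArg ψ hc
  have hyI : ψ y ∈ Set.Icc (ψ d₀) (ψ d₁) := h ▸ ⟨y, hy, rfl⟩
  rw [segment_eq_image']
  refine ⟨c, ⟨?_, ?_⟩, by simp [hc]⟩
  · refine le_of_mul_le_mul_right ?_ (sub_pos.2 hlt)
    linarith [hyI.1]
  · refine le_of_mul_le_mul_right ?_ (sub_pos.2 hlt)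
    linarith [hyI.2]

/-- The edge summand of a facet lies in a level set of the normal vector of the facet. -/
theorem inner_eq_of_face_add {w : EuclideanSpace ℝ (Fin n)}
    {C D : Set (EuclideanSpace ℝ (Fin n))} (hC : (face w C).Nonempty)
    (h : face w C + D = face w (C + D)) {x y : EuclideanSpace ℝ (Fin n)} (hx : x ∈ D)
    (hy : y ∈ D) : inner ℝ w x = inner ℝ w y := by
  obtain ⟨c, hc⟩ := hC
  have aux : ∀ x ∈ D, ∀ y ∈ D, inner ℝ w x ≤ inner ℝ w y := by
    intro x hx y hy
    have h1 : c + y ∈ face w (C + D) := h ▸ Set.add_mem_add hc hy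
    have := h1.2 (c + x) (Set.add_mem_add hc.1 hx)
    simpa [inner_add_right] using this
  exact (aux x hx y hy).antisymm (aux y hy x hx)

/-- The mixed fiber polytope of the facet is a translate of the face of the mixed fiber polytope
of the cell. -/
theorem IsEdgeCell.exists_mixedFiberPolytopes {w : EuclideanSpace ℝ (Fin n)}
    {C D : Set (EuclideanSpace ℝ (Fin n))} (h : IsEdgeCell ψ w C D) :
    ∃ M N v, IsMixedFiberPolytope ψ C D M ∧ IsMixedFiberPolytope ψ (face w C) D N ∧
      N = face w M + {v} := by
  have hC := h.mixed.lattice_left.isPolytope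
  have hF := hC.face w
  obtain ⟨d₀, hd₀, d₁, hd₁, hlt, hD⟩ :=
    h.mixed.lattice_right.isPolytope.eq_segment h.dim_right h.dim_image
  have hw := inner_eq_of_face_add hF.nonempty h.facet.1 hd₁ hd₀
  obtain ⟨a, b, -, hI⟩ := hC.exists_image_eq_Icc ψ
  obtain ⟨a', b', -, hI'⟩ := hF.exists_image_eq_Icc ψ
  rw [hD]
  refine ⟨_, _, b' • d₁ - a' • d₀ - (b • d₁ - a • d₀), isMixedFiberPolytope_segment hC hI hlt,
    isMixedFiberPolytope_segment hF hI' hlt, ?_⟩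
  -- The subtracted multiple of `d₁ - d₀` is invisible to `w`, which is constant on `D`.
  have hproj : ∀ x, inner ℝ w (projEdge ψ d₀ d₁ x) = (ψ d₁ - ψ d₀) * inner ℝ w x := by
    intro x
    rw [projEdge_apply, inner_sub_right, inner_smul_right, inner_smul_right, inner_sub_right, hw]
    ring
  rw [face_add_singleton, face_image (sub_pos.2 hlt) hproj, add_assoc,
    Set.singleton_add_singleton, add_sub_cancel]

end MixedFiber

theorem corollary4p10 {n : ℕ}
    (A : Matrix (Fin (n - 1)) (Fin n) ℚ) (ψ : EuclideanSpace ℝ (Fin n) →ₗ[ℝ] ℝ)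
    (hψ : MixedFiber.IsComplementaryMap A ψ)
    (w : EuclideanSpace ℝ (Fin n)) (C D : Set (EuclideanSpace ℝ (Fin n)))
    (hCD : MixedFiber.IsEdgeCell ψ w C D) :
    -- both mixed fiber polytopes are well defined
    (∃! M, MixedFiber.IsMixedFiberPolytope ψ C D M) ∧
    (∃! N, MixedFiber.IsMixedFiberPolytope ψ (MixedFiber.face w C) D N) ∧
    -- their difference, after passing to the face, is a single point
    (∃! v : EuclideanSpace ℝ (Fin n),
      MixedFiber.IsDifference (MixedFiber.mixedFiberPolytope ψ (MixedFiber.face w C) D)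
        (MixedFiber.face w (MixedFiber.mixedFiberPolytope ψ C D)) {v}) ∧
    -- the offset between neighboring cells
    (∀ C' D' : Set (EuclideanSpace ℝ (Fin n)), MixedFiber.IsEdgeCell ψ (-w) C' D' →
      MixedFiber.AreNeighbors w C D C' D' →
      ∀ v v' : EuclideanSpace ℝ (Fin n),
        MixedFiber.IsDifference (MixedFiber.mixedFiberPolytope ψ (MixedFiber.face w C) D)
          (MixedFiber.face w (MixedFiber.mixedFiberPolytope ψ C D)) {v} →
        MixedFiber.IsDifference (MixedFiber.mixedFiberPolytope ψ (MixedFiber.face (-w) C') D')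
          (MixedFiber.face (-w) (MixedFiber.mixedFiberPolytope ψ C' D')) {v'} →
        MixedFiber.face (-w) (MixedFiber.mixedFiberPolytope ψ C' D') =
          MixedFiber.face w (MixedFiber.mixedFiberPolytope ψ C D) + {v - v'}) := by
  obtain ⟨M, N, v, hM, hN, hv⟩ := hCD.exists_mixedFiberPolytopes
  refine ⟨⟨M, hM, fun _ h => h.unique hM⟩, ⟨N, hN, fun _ h => h.unique hN⟩, ?_, ?_⟩
  · rw [hM.mixedFiberPolytope_eq, hN.mixedFiberPolytope_eq]
    exact ⟨v, hv, fun v' hv' =>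
      MixedFiber.eq_of_add_singleton_eq (hM.1.face w) (hv'.symm.trans hv)⟩
  · intro C' D' hCD' hnb v v' hv hv'
    obtain ⟨M', N', -, -, hN', -⟩ := hCD'.exists_mixedFiberPolytopes
    -- The common facet has one mixed fiber polytope; if the summands are swapped, symmetry
    -- identifies the two.
    have hNN : N = N' := by
      rcases hnb with ⟨h₁, h₂⟩ | ⟨h₁, h₂⟩
      · rw [← h₁, ← h₂] at hN'
        exact hN.unique hN'
      · rw [← h₁, ← h₂] at hN'
        exact hN.unique hN'.symm
    unfold MixedFiber.IsDifference at hv hv'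
    rw [hN.mixedFiberPolytope_eq] at hv
    rw [hN'.mixedFiberPolytope_eq, ← hNN, hv] at hv'
    have := congrArg (fun X => X + {-v'}) hv'
    simp only [add_assoc, Set.singleton_add_singleton, add_neg_cancel, Set.singleton_zero,
      add_zero] at this
    rw [sub_eq_add_neg]
    exact this.symm
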